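/- Let $\alpha,\epsilon>0$ be real numbers. Then there is a natural number $N_0=N_0(\alpha,\epsilon)$ such that for every integer $N>N_0$ and every set $A\subseteq\{1,\dots,N\}$ with $|A|=\alpha N$ there is an integer $d\neq 0$ such that $A$ contains at least $(\alpha^3-\epsilon)N$ three-term arithmetic progressions with common difference $d$; that is, $$\left|\{x\in\mathbb{Z} : x,\ x+d,\ x+2d\in A\}\right|\ \geq\ (\alpha^3-\epsilon)N .$$ -/

import Mathlib

/-- The number of three-term arithmetic progressions `(x, x + d, x + 2d)` with
common difference `d`, all of whose terms lie in `A`. -/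
def numThreeAP (A : Finset ℤ) (d : ℤ) : ℕ :=
  (A.filter fun x => x + d ∈ A ∧ x + 2 * d ∈ A).card

/-! Embed `A` in ℤ/(4N+1) with indicator function f, and average the progression count over d with
weight `autocorr B`, the law of b - b' for independent uniform b, b' in a set `B`. Choose `B` of
size at least a constant times n, such that the characters in the large spectrum of f, and the
frequency 1, are nearly constant on `B`.

Then f(x+2d) may be replaced by its smoothing s(x+2d), since f - s has negligible Fourier transform
for counting purposes (`abs_sum_progression_le`), and s(x+2d) by s(x), since s barely changes under
such shifts (`sum_abs_smoothed_sub_le`). Averaging f(x+d) over d yields another s(x), so the count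
is close to ∑ f s² (`abs_progression_sub_le`). Energy pigeonholing supplies suitable spectra
(`exists_progression_regular`).

Frequency 1 forces `B` to be short, so A + B has about N elements rather than n. Two applications of
Cauchy–Schwarz then give ∑ f s² ≥ α³N up to a small error (`sum_pow_three_le`). The trivial
difference d = 0 contributes at most N/#B, which is bounded, so some d ≠ 0 reaches the required
count. -/

namespace PopularDifference

open Finset ComplexConjugate
open scoped Pointwise

/-! ### Autocorrelation weights and Fourier analysis on ℤ/nℤ. -/

variable {n : ℕ}

/-- The probability weight of the differences of two independent uniform elements of `B`. -/
noncomputable def autocorr (B : Finset (ZMod n)) (d : ZMod n) : ℝ :=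
  #{p ∈ B ×ˢ B | p.1 - p.2 = d} / (#B : ℝ) ^ 2

lemma autocorr_nonneg (B : Finset (ZMod n)) (d : ZMod n) : 0 ≤ autocorr B d := by
  unfold autocorr; positivity

lemma exists_sub_eq_of_autocorr_ne_zero {B : Finset (ZMod n)} {d : ZMod n}
    (h : autocorr B d ≠ 0) : ∃ b ∈ B, ∃ b' ∈ B, b - b' = d := by
  have : #{p ∈ B ×ˢ B | p.1 - p.2 = d} ≠ 0 := fun h' ↦ h (by simp [autocorr, h'])
  obtain ⟨p, hp⟩ := card_ne_zero.1 this
  simp only [mem_filter, mem_product] at hp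
  exact ⟨p.1, hp.1.1, p.2, hp.1.2, hp.2⟩

variable [NeZero n]

/-- The discrete Fourier transform of a real-valued function on `ℤ/nℤ`. -/
noncomputable def realDFT (f : ZMod n → ℝ) (ξ : ZMod n) : ℂ :=
  ZMod.dft (fun x ↦ (f x : ℂ)) ξ

lemma realDFT_apply (f : ZMod n → ℝ) (ξ : ZMod n) :
    realDFT f ξ = ∑ x, ZMod.stdAddChar (-(x * ξ)) * (f x : ℂ) := by
  simp [realDFT, ZMod.dft_apply]

lemma conj_stdAddChar (x : ZMod n) :
    conj (ZMod.stdAddChar x : ℂ) = ZMod.stdAddChar (-x) := by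
  rw [AddChar.map_neg_eq_conj]

lemma norm_stdAddChar (x : ZMod n) : ‖(ZMod.stdAddChar x : ℂ)‖ = 1 := by
  rw [ZMod.stdAddChar_apply, Circle.norm_coe]

lemma conj_realDFT (f : ZMod n → ℝ) (ξ : ZMod n) :
    conj (realDFT f ξ) = ∑ x, ZMod.stdAddChar (x * ξ) * (f x : ℂ) := by
  simp [realDFT_apply, conj_stdAddChar]

lemma realDFT_inversion (f : ZMod n → ℝ) (x : ZMod n) :
    ∑ ξ, ZMod.stdAddChar (ξ * x) * realDFT f ξ = n * (f x : ℂ) := by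
  have h := congrFun (ZMod.dft.symm_apply_apply (fun x ↦ (f x : ℂ))) x
  rw [ZMod.invDFT_apply] at h
  simp only [smul_eq_mul] at h
  rw [← h, ← mul_assoc, mul_inv_cancel₀ (NeZero.ne _), one_mul]
  rfl

theorem sum_realDFT_mul_conj (f g : ZMod n → ℝ) :
    ∑ ξ, realDFT f ξ * conj (realDFT g ξ) = ((n * ∑ x, f x * g x : ℝ) : ℂ) := by
  simp_rw [conj_realDFT, mul_sum]
  rw [sum_comm]
  rw [Complex.ofReal_sum]
  refine sum_congr rfl fun x _ ↦ ?_
  push_cast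
  rw [← mul_assoc, ← realDFT_inversion f x, sum_mul]
  refine sum_congr rfl fun ξ _ ↦ ?_
  rw [mul_comm x ξ]; ring

theorem sum_norm_realDFT_sq (f : ZMod n → ℝ) :
    ∑ ξ, ‖realDFT f ξ‖ ^ 2 = n * ∑ x, f x ^ 2 := by
  have h := sum_realDFT_mul_conj f f
  simp_rw [Complex.mul_conj, Complex.normSq_eq_norm_sq, ← pow_two] at h
  exact_mod_cast h

lemma sum_norm_realDFT_sq_le {f : ZMod n → ℝ} (hf : ∀ x, |f x| ≤ 1) :
    ∑ ξ, ‖realDFT f ξ‖ ^ 2 ≤ (n : ℝ) ^ 2 := by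
  rw [sum_norm_realDFT_sq, pow_two]
  gcongr
  calc ∑ x, f x ^ 2 ≤ ∑ _x : ZMod n, (1 : ℝ) :=
        sum_le_sum fun x _ ↦ (sq_le_one_iff_abs_le_one _).2 (hf x)
    _ = n := by simp [ZMod.card]

/-- Groups the pairs (b, b') by their difference. Module-valued `G` covers both real averages and
complex character sums. -/
lemma sum_autocorr_smul {E : Type*} [AddCommGroup E] [Module ℝ E] (B : Finset (ZMod n))
    (G : ZMod n → E) :
    ∑ d, autocorr B d • G d = ((#B : ℝ) ^ 2)⁻¹ • ∑ b ∈ B, ∑ b' ∈ B, G (b - b') := by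
  rw [← sum_product', ← sum_fiberwise (B ×ˢ B) (fun p ↦ p.1 - p.2), smul_sum]
  refine sum_congr rfl fun d _ ↦ ?_
  rw [sum_congr rfl (g := fun _ ↦ G d)
    fun p hp ↦ by rw [(mem_filter.1 hp).2], sum_const, autocorr,
    ← Nat.cast_smul_eq_nsmul ℝ, smul_smul, div_eq_inv_mul]

lemma sum_autocorr {B : Finset (ZMod n)} (hB : B.Nonempty) : ∑ d, autocorr B d = 1 := by
  have h := sum_autocorr_smul B (fun _ ↦ (1 : ℝ))
  have : (#B : ℝ) ≠ 0 := by simpa using hB.ne_empty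
  simp only [smul_eq_mul, mul_one, sum_const, nsmul_eq_mul] at h
  rw [h]; field_simp

lemma autocorr_zero {B : Finset (ZMod n)} (hB : B.Nonempty) : autocorr B 0 = (#B : ℝ)⁻¹ := by
  have h := sum_autocorr_smul B (fun d ↦ if d = 0 then (1 : ℝ) else 0)
  have : (#B : ℝ) ≠ 0 := by simpa using hB.ne_empty
  simp only [smul_eq_mul, mul_ite, mul_one, mul_zero, sum_ite_eq', mem_univ, if_true,
    sub_eq_zero, sum_ite_eq] at h
  rw [h]
  simp only [sum_ite_mem, inter_self, sum_const, nsmul_eq_mul, mul_one]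
  field_simp

/-- The Fourier transform of `autocorr B`, which is real and nonnegative. -/
noncomputable def autocorrDFT (B : Finset (ZMod n)) (ξ : ZMod n) : ℝ :=
  ‖∑ b ∈ B, (ZMod.stdAddChar (b * ξ) : ℂ)‖ ^ 2 / (#B : ℝ) ^ 2

lemma autocorrDFT_nonneg (B : Finset (ZMod n)) (ξ : ZMod n) : 0 ≤ autocorrDFT B ξ := by
  unfold autocorrDFT; positivity

lemma autocorrDFT_le_one (B : Finset (ZMod n)) (ξ : ZMod n) : autocorrDFT B ξ ≤ 1 := by
  refine div_le_one_of_le₀ ?_ (by positivity)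
  gcongr
  refine (norm_sum_le _ _).trans ?_
  simp

lemma sum_autocorr_mul_stdAddChar (B : Finset (ZMod n)) (ξ : ZMod n) :
    ∑ d, (autocorr B d : ℂ) * ZMod.stdAddChar (d * ξ) = autocorrDFT B ξ := by
  have h := sum_autocorr_smul B (fun d ↦ (ZMod.stdAddChar (d * ξ) : ℂ))
  simp only [Complex.real_smul] at h
  rw [h, autocorrDFT]
  push_cast
  rw [← Complex.mul_conj', map_sum, sum_mul_sum, div_eq_inv_mul]
  simp_rw [conj_stdAddChar, ← AddChar.map_add_eq_mul, sub_mul, sub_eq_add_neg]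

lemma realDFT_autocorr (B : Finset (ZMod n)) (ξ : ZMod n) :
    realDFT (autocorr B) ξ = autocorrDFT B ξ := by
  have h := conj_realDFT (autocorr B) ξ
  simp_rw [mul_comm (ZMod.stdAddChar _ : ℂ)] at h
  rw [sum_autocorr_mul_stdAddChar] at h
  rw [← Complex.conj_conj (realDFT _ _), h, Complex.conj_ofReal]

lemma sum_autocorrDFT {B : Finset (ZMod n)} (hB : B.Nonempty) :
    ∑ ξ, autocorrDFT B ξ = n / #B := by
  have h := realDFT_inversion (autocorr B) 0
  simp only [mul_zero, AddChar.map_zero_eq_one, one_mul, realDFT_autocorr,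
    autocorr_zero hB] at h
  rw [div_eq_mul_inv]
  exact_mod_cast h

/-- The average of `f` around `x` with respect to `autocorr B`. -/
noncomputable def smoothed (B : Finset (ZMod n)) (f : ZMod n → ℝ) (x : ZMod n) : ℝ :=
  ∑ d, autocorr B d * f (x + d)

lemma realDFT_comp_add (f : ZMod n → ℝ) (d ξ : ZMod n) :
    realDFT (fun x ↦ f (x + d)) ξ = ZMod.stdAddChar (d * ξ) * realDFT f ξ := by
  simp_rw [realDFT_apply, mul_sum]
  refine Fintype.sum_equiv (Equiv.addRight d) _ _ fun x ↦ ?_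
  rw [Equiv.coe_addRight, ← mul_assoc, ← AddChar.map_add_eq_mul]
  congr 2; ring_nf

lemma realDFT_smoothed (B : Finset (ZMod n)) (f : ZMod n → ℝ) (ξ : ZMod n) :
    realDFT (smoothed B f) ξ = autocorrDFT B ξ * realDFT f ξ := by
  rw [← sum_autocorr_mul_stdAddChar, sum_mul]
  simp_rw [mul_assoc, ← realDFT_comp_add, realDFT_apply, smoothed, mul_sum]
  push_cast
  simp_rw [mul_sum]
  rw [sum_comm]
  refine sum_congr rfl fun d _ ↦ sum_congr rfl fun x _ ↦ by ring

lemma realDFT_sub (f g : ZMod n → ℝ) (ξ : ZMod n) :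
    realDFT (fun x ↦ f x - g x) ξ = realDFT f ξ - realDFT g ξ := by
  simp [realDFT_apply, mul_sub]

lemma smoothed_mem_Icc {B : Finset (ZMod n)} (hB : B.Nonempty) {f : ZMod n → ℝ}
    (hf : ∀ x, f x ∈ Set.Icc (0 : ℝ) 1) (x : ZMod n) : smoothed B f x ∈ Set.Icc (0 : ℝ) 1 := by
  refine ⟨sum_nonneg fun d _ ↦ mul_nonneg (autocorr_nonneg B d) (hf _).1, ?_⟩
  rw [← sum_autocorr hB]
  exact sum_le_sum fun d _ ↦ mul_le_of_le_one_right (autocorr_nonneg B d) (hf _).2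

/-! ### Progression counts through the dual function. -/

/-- A product of two functions along `(y - 2d, y - d)`, twisted by a character in `d`, has a
factorised Fourier transform. -/
lemma sum_twisted_eq (f : ZMod n → ℝ) (ζ ξ : ZMod n) :
    ∑ y, ∑ d, ZMod.stdAddChar (d * ζ) * (ZMod.stdAddChar (-(y * ξ)) *
      ((f (y - 2 * d) : ℂ) * f (y - d))) =
    realDFT f (ζ - ξ) * realDFT f (2 * ξ - ζ) := by
  rw [sum_comm]
  have h (d : ZMod n) : ∑ y, (ZMod.stdAddChar (d * ζ) : ℂ) * (ZMod.stdAddChar (-(y * ξ)) *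
      ((f (y - 2 * d) : ℂ) * f (y - d))) =
      ∑ u, (ZMod.stdAddChar (d * ζ) : ℂ) * (ZMod.stdAddChar (-((u + 2 * d) * ξ)) *
      ((f u : ℂ) * f (u + d))) := by
    symm
    refine Fintype.sum_equiv (Equiv.addRight (2 * d)) _ _ fun u ↦ ?_
    simp only [Equiv.coe_addRight, add_sub_cancel_right]
    rw [show u + 2 * d - d = u + d by ring]
  simp_rw [h]
  rw [sum_comm, realDFT_apply, realDFT_apply, sum_mul_sum]
  refine sum_congr rfl fun u _ ↦ ?_
  refine Fintype.sum_equiv (Equiv.addLeft u) _ _ fun d ↦ ?_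
  simp only [Equiv.coe_addLeft]
  have : (ZMod.stdAddChar (d * ζ) : ℂ) * ZMod.stdAddChar (-((u + 2 * d) * ξ)) =
      ZMod.stdAddChar (-(u * (ζ - ξ))) * ZMod.stdAddChar (-((u + d) * (2 * ξ - ζ))) := by
    rw [← AddChar.map_add_eq_mul, ← AddChar.map_add_eq_mul]
    congr 1; ring
  calc _ = ((ZMod.stdAddChar (d * ζ) : ℂ) * ZMod.stdAddChar (-((u + 2 * d) * ξ))) *
        ((f u : ℂ) * f (u + d)) := by ring
    _ = _ := by rw [this]; ring

/-- The weighted count of pairs `(y - 2d, y - d)` preceding `y`. -/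
noncomputable def dualFun (B : Finset (ZMod n)) (f : ZMod n → ℝ) (y : ZMod n) : ℝ :=
  ∑ d, autocorr B d * (f (y - 2 * d) * f (y - d))

/-- Expand the weight by Fourier inversion; each character then contributes one instance of
`sum_twisted_eq`. -/
lemma realDFT_dualFun (B : Finset (ZMod n)) (f : ZMod n → ℝ) (ξ : ZMod n) :
    (n : ℂ) * realDFT (dualFun B f) ξ =
      ∑ ζ, (autocorrDFT B ζ : ℂ) * (realDFT f (ζ - ξ) * realDFT f (2 * ξ - ζ)) := by
  simp_rw [← sum_twisted_eq, mul_sum]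
  rw [realDFT_apply, mul_sum, sum_comm]
  refine sum_congr rfl fun y _ ↦ ?_
  rw [sum_comm, dualFun, Complex.ofReal_sum, mul_sum, mul_sum]
  refine sum_congr rfl fun d _ ↦ ?_
  have h := realDFT_inversion (autocorr B) d
  push_cast
  rw [← mul_assoc, ← mul_assoc, mul_comm (n : ℂ), mul_assoc _ (n : ℂ), ← h, mul_sum, sum_mul]
  refine sum_congr rfl fun ζ _ ↦ ?_
  rw [realDFT_autocorr, mul_comm d ζ]; ring

/-- AM-GM and Parseval: for odd n both ξ ↦ ζ - ξ and ξ ↦ 2ξ - ζ permute the frequencies. -/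
lemma sum_norm_realDFT_mul_le {f : ZMod n → ℝ} (hf : ∀ x, |f x| ≤ 1) (hn : Odd n) (ζ : ZMod n) :
    ∑ ξ, ‖realDFT f (ζ - ξ)‖ * ‖realDFT f (2 * ξ - ζ)‖ ≤ (n : ℝ) ^ 2 := by
  have h2 : IsUnit (2 : ZMod n) := by
    have := (ZMod.isUnit_iff_coprime 2 n).2 (Nat.coprime_two_left.2 hn)
    exact_mod_cast this
  have e1 : ∑ ξ, ‖realDFT f (ζ - ξ)‖ ^ 2 = ∑ ξ, ‖realDFT f ξ‖ ^ 2 :=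
    Fintype.sum_equiv (Equiv.subLeft ζ) _ _ fun ξ ↦ rfl
  have e2 : ∑ ξ, ‖realDFT f (2 * ξ - ζ)‖ ^ 2 = ∑ ξ, ‖realDFT f ξ‖ ^ 2 :=
    Fintype.sum_bijective (fun ξ ↦ 2 * ξ - ζ)
      ((Equiv.subRight ζ).bijective.comp h2.unit.mulLeft_bijective) _ _ fun ξ ↦ rfl
  calc ∑ ξ, ‖realDFT f (ζ - ξ)‖ * ‖realDFT f (2 * ξ - ζ)‖
      ≤ ∑ ξ, (‖realDFT f (ζ - ξ)‖ ^ 2 + ‖realDFT f (2 * ξ - ζ)‖ ^ 2) / 2 :=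
        sum_le_sum fun ξ _ ↦ by
          nlinarith [sq_nonneg (‖realDFT f (ζ - ξ)‖ - ‖realDFT f (2 * ξ - ζ)‖)]
    _ = ∑ ξ, ‖realDFT f ξ‖ ^ 2 := by
        rw [← sum_div, sum_add_distrib, e1, e2]; ring
    _ ≤ _ := sum_norm_realDFT_sq_le hf

/-- An ℓ¹ Fourier bound that loses only the factor n/#B; it makes a uniform bound on the other
function's transform sufficient. -/
lemma sum_norm_realDFT_dualFun_le {B : Finset (ZMod n)} (hB : B.Nonempty) {f : ZMod n → ℝ}
    (hf : ∀ x, |f x| ≤ 1) (hn : Odd n) :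
    ∑ ξ, ‖realDFT (dualFun B f) ξ‖ ≤ (n : ℝ) ^ 2 / #B := by
  have hn0 : (0 : ℝ) < n := Nat.cast_pos.2 (NeZero.pos n)
  have h (ξ : ZMod n) : n * ‖realDFT (dualFun B f) ξ‖ ≤
      ∑ ζ, autocorrDFT B ζ * (‖realDFT f (ζ - ξ)‖ * ‖realDFT f (2 * ξ - ζ)‖) := by
    have h1 := congrArg norm (realDFT_dualFun B f ξ)
    rw [norm_mul, Complex.norm_natCast] at h1
    rw [h1]
    refine (norm_sum_le _ _).trans (sum_le_sum fun ζ _ ↦ ?_)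
    rw [norm_mul, norm_mul, Complex.norm_real, Real.norm_of_nonneg (autocorrDFT_nonneg B ζ)]
  refine le_of_mul_le_mul_left ?_ hn0
  rw [mul_sum]
  calc _ ≤ ∑ ξ, ∑ ζ, autocorrDFT B ζ * (‖realDFT f (ζ - ξ)‖ * ‖realDFT f (2 * ξ - ζ)‖) :=
        sum_le_sum fun ξ _ ↦ h ξ
    _ ≤ ∑ ζ, autocorrDFT B ζ * (n : ℝ) ^ 2 := by
        rw [sum_comm]
        refine sum_le_sum fun ζ _ ↦ ?_
        rw [← mul_sum]
        exact mul_le_mul_of_nonneg_left (sum_norm_realDFT_mul_le hf hn ζ) (autocorrDFT_nonneg B ζ)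
    _ = _ := by rw [← sum_mul, sum_autocorrDFT hB]; ring

lemma abs_dualFun_le {B : Finset (ZMod n)} (hB : B.Nonempty) {f : ZMod n → ℝ}
    (hf : ∀ x, |f x| ≤ 1) (y : ZMod n) : |dualFun B f y| ≤ 1 := by
  rw [← sum_autocorr hB]
  refine (abs_sum_le_sum_abs _ _).trans (sum_le_sum fun d _ ↦ ?_)
  rw [abs_mul, abs_of_nonneg (autocorr_nonneg B d), abs_mul]
  exact mul_le_of_le_one_right (autocorr_nonneg B d)
    (mul_le_one₀ (hf _) (abs_nonneg _) (hf _))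

lemma sum_mul_dualFun (B : Finset (ZMod n)) (f h : ZMod n → ℝ) :
    ∑ y, h y * dualFun B f y =
      ∑ d, autocorr B d * ∑ x, f x * f (x + d) * h (x + 2 * d) := by
  simp_rw [dualFun, mul_sum]
  rw [sum_comm]
  refine sum_congr rfl fun d _ ↦ ?_
  symm
  refine Fintype.sum_equiv (Equiv.addRight (2 * d)) _ _ fun x ↦ ?_
  simp only [Equiv.coe_addRight, add_sub_cancel_right]
  rw [show x + 2 * d - d = x + d by ring]; ring

/-- Three-term progression counts are controlled by the Fourier transform of the last function:
it may be small in square mean on a set `S`, and uniformly small off `S`. -/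
theorem abs_sum_progression_le {B : Finset (ZMod n)} (hB : B.Nonempty) {f h : ZMod n → ℝ}
    (hf : ∀ x, |f x| ≤ 1) (hn : Odd n) {S : Finset (ZMod n)} {a η : ℝ} (ha : 0 ≤ a) (hη : 0 ≤ η)
    (hS : ∑ ξ ∈ S, ‖realDFT h ξ‖ ^ 2 ≤ (a * n) ^ 2) (hS' : ∀ ξ ∉ S, ‖realDFT h ξ‖ ≤ η * n) :
    |∑ d, autocorr B d * ∑ x, f x * f (x + d) * h (x + 2 * d)| ≤ (a + η * (n / #B)) * n := by
  have hn0 : (0 : ℝ) < n := Nat.cast_pos.2 (NeZero.pos n)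
  rw [← sum_mul_dualFun]
  refine le_of_mul_le_mul_left ?_ hn0
  have h1 := congrArg norm (sum_realDFT_mul_conj h (dualFun B f))
  rw [Complex.norm_real, Real.norm_eq_abs, abs_mul, abs_of_pos hn0] at h1
  rw [← h1]
  -- On `S`, Cauchy–Schwarz and Parseval; off `S`, the sup bound against the ℓ¹ bound.
  have h2 : ∑ ξ ∈ S, ‖realDFT h ξ‖ * ‖realDFT (dualFun B f) ξ‖ ≤ a * n * n := by
    have h3 : ∑ ξ ∈ S, ‖realDFT (dualFun B f) ξ‖ ^ 2 ≤ (n : ℝ) ^ 2 :=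
      (sum_le_univ_sum_of_nonneg fun ξ ↦ sq_nonneg _).trans
        (sum_norm_realDFT_sq_le (abs_dualFun_le hB hf))
    have h4 : (∑ ξ ∈ S, ‖realDFT h ξ‖ * ‖realDFT (dualFun B f) ξ‖) ^ 2 ≤ (a * n * n) ^ 2 := by
      rw [mul_pow (a * n)]
      exact (sum_mul_sq_le_sq_mul_sq _ _ _).trans
        (mul_le_mul hS h3 (sum_nonneg fun ξ _ ↦ sq_nonneg _) (sq_nonneg _))
    exact (abs_le_of_sq_le_sq' h4 (by positivity)).2
  have h3 : ∑ ξ ∈ Sᶜ, ‖realDFT h ξ‖ * ‖realDFT (dualFun B f) ξ‖ ≤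
      η * n * ((n : ℝ) ^ 2 / #B) := by
    calc _ ≤ ∑ ξ ∈ Sᶜ, η * n * ‖realDFT (dualFun B f) ξ‖ :=
          sum_le_sum fun ξ hξ ↦
            mul_le_mul_of_nonneg_right (hS' ξ (mem_compl.1 hξ)) (norm_nonneg _)
      _ ≤ η * n * ∑ ξ, ‖realDFT (dualFun B f) ξ‖ := by
          rw [← mul_sum]
          exact mul_le_mul_of_nonneg_left
            (sum_le_univ_sum_of_nonneg fun ξ ↦ norm_nonneg _) (by positivity)
      _ ≤ _ := mul_le_mul_of_nonneg_left (sum_norm_realDFT_dualFun_le hB hf hn) (by positivity)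
  calc _ ≤ ∑ ξ, ‖realDFT h ξ‖ * ‖realDFT (dualFun B f) ξ‖ := by
        refine (norm_sum_le _ _).trans_eq (sum_congr rfl fun ξ _ ↦ ?_)
        rw [norm_mul, RCLike.norm_conj]
    _ ≤ a * n * n + η * n * ((n : ℝ) ^ 2 / #B) := by
        rw [← sum_add_sum_compl S]; exact add_le_add h2 h3
    _ = _ := by ring

/-! ### Near invariance of smoothed functions. -/

/-- A smoothed function is nearly invariant under a shift which nearly preserves its large
Fourier modes. -/
theorem sum_abs_smoothed_sub_le {B : Finset (ZMod n)} (hB : B.Nonempty) {f : ZMod n → ℝ}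
    {t : ZMod n} {S : Finset (ZMod n)} {a η : ℝ}
    (hS : ∑ ξ ∈ S, ‖realDFT f ξ‖ ^ 2 * ‖(ZMod.stdAddChar (t * ξ) : ℂ) - 1‖ ^ 2 ≤ (a * n) ^ 2)
    (hS' : ∀ ξ ∉ S, ‖realDFT f ξ‖ ≤ η * n) :
    ∑ x, |smoothed B f (x + t) - smoothed B f x| ≤ √(a ^ 2 + 4 * η ^ 2 * (n / #B)) * n := by
  have hn0 : (0 : ℝ) < n := Nat.cast_pos.2 (NeZero.pos n)
  set h : ZMod n → ℝ := fun x ↦ smoothed B f (x + t) - smoothed B f x with hh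
  have hdft (ξ : ZMod n) : ‖realDFT h ξ‖ ^ 2 = autocorrDFT B ξ ^ 2 *
      (‖realDFT f ξ‖ ^ 2 * ‖(ZMod.stdAddChar (t * ξ) : ℂ) - 1‖ ^ 2) := by
    rw [hh, realDFT_sub (fun x ↦ smoothed B f (x + t)), realDFT_comp_add, realDFT_smoothed,
      ← sub_one_mul, norm_mul, norm_mul, Complex.norm_real, Real.norm_eq_abs, mul_pow, mul_pow,
      sq_abs]
    ring
  have hsq : ∑ x, h x ^ 2 ≤ (a ^ 2 + 4 * η ^ 2 * (n / #B)) * n := by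
    refine le_of_mul_le_mul_left ?_ hn0
    rw [← sum_norm_realDFT_sq, ← sum_add_sum_compl S]
    have h1 : ∑ ξ ∈ S, ‖realDFT h ξ‖ ^ 2 ≤ (a * n) ^ 2 := by
      refine (sum_le_sum fun ξ _ ↦ ?_).trans hS
      rw [hdft]
      exact mul_le_of_le_one_left (by positivity)
        (pow_le_one₀ (autocorrDFT_nonneg B ξ) (autocorrDFT_le_one B ξ))
    -- One of the two factors `autocorrDFT B ξ` is kept, because its sum over all frequencies is
    -- n/#B.
    have h2 : ∑ ξ ∈ Sᶜ, ‖realDFT h ξ‖ ^ 2 ≤ (n / #B) * ((η * n) ^ 2 * 4) := by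
      rw [← sum_autocorrDFT hB, sum_mul]
      refine (sum_le_sum fun ξ hξ ↦ ?_).trans (sum_le_univ_sum_of_nonneg fun ξ ↦
        mul_nonneg (autocorrDFT_nonneg B ξ) (by positivity))
      rw [hdft]
      have h3 : ‖(ZMod.stdAddChar (t * ξ) : ℂ) - 1‖ ≤ 2 := by
        refine (norm_sub_le _ _).trans ?_
        rw [norm_stdAddChar, norm_one]; norm_num
      refine mul_le_mul ?_ ?_ (by positivity) (autocorrDFT_nonneg B ξ)
      · rw [pow_two]
        exact mul_le_of_le_one_left (autocorrDFT_nonneg B ξ) (autocorrDFT_le_one B ξ)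
      · refine mul_le_mul (pow_le_pow_left₀ (norm_nonneg _) (hS' ξ (mem_compl.1 hξ)) 2) ?_
          (by positivity) (by positivity)
        calc _ ≤ (2 : ℝ) ^ 2 := pow_le_pow_left₀ (norm_nonneg _) h3 2
          _ = 4 := by norm_num
    calc _ ≤ _ := add_le_add h1 h2
      _ = _ := by ring
  refine (abs_le_of_sq_le_sq' ?_ (by positivity)).2
  calc (∑ x, |h x|) ^ 2 ≤ #(univ : Finset (ZMod n)) * ∑ x, |h x| ^ 2 := sq_sum_le_card_mul_sum_sq
    _ = n * ∑ x, h x ^ 2 := by simp [ZMod.card]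
    _ ≤ n * ((a ^ 2 + 4 * η ^ 2 * (n / #B)) * n) := mul_le_mul_of_nonneg_left hsq hn0.le
    _ = _ := by rw [mul_pow, Real.sq_sqrt (by positivity)]; ring

/-! ### Choice of `B` and stability of the spectrum. -/

/-- A bounded number of frequencies is nearly constant on a dense set. -/
theorem exists_dense_almost_constant {ρ : ℝ} (hρ : 0 < ρ) :
    ∃ m : ℕ, 0 < m ∧ ∀ (n : ℕ) [NeZero n] (S : Finset (ZMod n)),
      ∃ B : Finset (ZMod n), 0 ∈ B ∧ (n : ℝ) ≤ (m : ℝ) ^ #S * #B ∧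
        ∀ b ∈ B, ∀ b' ∈ B, ∀ ξ ∈ S, ‖(ZMod.stdAddChar ((b - b') * ξ) : ℂ) - 1‖ ≤ ρ := by
  -- Cover the unit disc by finitely many balls of radius ρ/2 and pigeonhole x by the balls
  -- containing its character values.
  obtain ⟨t, -, htf, hcov⟩ := (isCompact_closedBall (0 : ℂ) 1).finite_cover_balls (half_pos hρ)
  lift t to Finset ℂ using htf
  have hc : ∀ z : ℂ, ∃ c, ‖z‖ ≤ 1 → c ∈ t ∧ dist z c < ρ / 2 := by
    intro z
    by_cases hz : ‖z‖ ≤ 1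
    · have := hcov (mem_closedBall_zero_iff.2 hz)
      simp only [Set.mem_iUnion, Metric.mem_ball] at this
      obtain ⟨c, hc, hd⟩ := this
      exact ⟨c, fun _ ↦ ⟨hc, hd⟩⟩
    · exact ⟨0, fun h ↦ absurd h hz⟩
  choose c hc using hc
  have hm : 0 < #t := card_pos.2 ⟨c 0, (hc 0 (by simp)).1⟩
  refine ⟨#t, hm, fun n _ S ↦ ?_⟩
  have hn0 : (0 : ℝ) < n := Nat.cast_pos.2 (NeZero.pos n)
  have hm' : (0 : ℝ) < (#t : ℝ) ^ #S := by positivity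
  set φ : ZMod n → (S → ℂ) := fun x ξ ↦ c (ZMod.stdAddChar (x * (ξ : ZMod n))) with hφ
  obtain ⟨y, -, hy⟩ := exists_le_card_fiber_of_nsmul_le_card_of_maps_to
    (s := (univ : Finset (ZMod n))) (t := Fintype.piFinset fun _ : S ↦ t) (f := φ)
    (b := (n : ℝ) / (#t : ℝ) ^ #S)
    (fun x _ ↦ Fintype.mem_piFinset.2 fun ξ ↦ (hc _ (norm_stdAddChar _).le).1)
    ⟨fun _ ↦ c 0, Fintype.mem_piFinset.2 fun _ ↦ (hc 0 (by simp)).1⟩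
    (by
      simp only [nsmul_eq_mul, Fintype.card_piFinset, prod_const, card_univ, Fintype.card_coe, ZMod.card,
        Nat.cast_pow]
      exact (mul_div_cancel₀ _ hm'.ne').le)
  set A : Finset (ZMod n) := {x | φ x = y} with hA
  obtain ⟨b₀, hb₀⟩ : A.Nonempty := by
    rw [← card_pos]
    exact_mod_cast (div_pos hn0 hm').trans_le hy
  -- Translating the fibre puts 0 in `B` and leaves differences unchanged.
  refine ⟨A.image (· - b₀), mem_image.2 ⟨b₀, hb₀, sub_self _⟩, ?_, ?_⟩
  · rw [card_image_of_injective _ (sub_left_injective), mul_comm]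
    exact (div_le_iff₀ hm').1 hy
  · simp only [mem_image, forall_exists_index, and_imp, forall_apply_eq_imp_iff₂]
    intro a ha a' ha' ξ hξ
    have haa : φ a ⟨ξ, hξ⟩ = φ a' ⟨ξ, hξ⟩ := by
      rw [(mem_filter.1 ha).2, (mem_filter.1 ha').2]
    have h1 := (hc _ (norm_stdAddChar (a * ξ)).le).2
    have h2 := (hc _ (norm_stdAddChar (a' * ξ)).le).2
    simp only [hφ] at haa
    rw [haa] at h1
    have h3 : dist (ZMod.stdAddChar (a * ξ) : ℂ) (ZMod.stdAddChar (a' * ξ)) ≤ ρ := by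
      rw [dist_comm _ (c _)] at h2
      linarith [dist_triangle (ZMod.stdAddChar (a * ξ) : ℂ) (c (ZMod.stdAddChar (a' * ξ)))
        (ZMod.stdAddChar (a' * ξ))]
    have h4 : (ZMod.stdAddChar (a * ξ) : ℂ) - ZMod.stdAddChar (a' * ξ) =
        ZMod.stdAddChar (a' * ξ) * (ZMod.stdAddChar ((a - b₀ - (a' - b₀)) * ξ) - 1) := by
      rw [mul_sub, ← AddChar.map_add_eq_mul, mul_one]
      congr 2; ring
    rwa [dist_eq_norm, h4, norm_mul, norm_stdAddChar, one_mul] at h3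

/-- The frequencies at which the Fourier transform of `f` exceeds `η n`. -/
noncomputable def largeSpectrum (f : ZMod n → ℝ) (η : ℝ) : Finset (ZMod n) :=
  {ξ | η * n < ‖realDFT f ξ‖}

lemma mem_largeSpectrum {f : ZMod n → ℝ} {η : ℝ} {ξ : ZMod n} :
    ξ ∈ largeSpectrum f η ↔ η * n < ‖realDFT f ξ‖ := by
  simp [largeSpectrum]

lemma largeSpectrum_anti (f : ZMod n → ℝ) {η η' : ℝ} (h : η' ≤ η) :
    largeSpectrum f η ⊆ largeSpectrum f η' := fun ξ hξ ↦ by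
  rw [mem_largeSpectrum] at *
  exact (mul_le_mul_of_nonneg_right h (Nat.cast_nonneg n)).trans_lt hξ

lemma card_largeSpectrum_le {f : ZMod n → ℝ} (hf : ∀ x, |f x| ≤ 1) {η : ℝ} (hη : 0 < η) :
    #(largeSpectrum f η) ≤ ⌊1 / η ^ 2⌋₊ := by
  have hn0 : (0 : ℝ) < n := Nat.cast_pos.2 (NeZero.pos n)
  refine Nat.le_floor ((le_div_iff₀ (by positivity)).2 ?_)
  have h : #(largeSpectrum f η) * (η * n) ^ 2 ≤ (n : ℝ) ^ 2 :=
    calc _ = ∑ _ξ ∈ largeSpectrum f η, (η * n) ^ 2 := by simp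
      _ ≤ ∑ ξ ∈ largeSpectrum f η, ‖realDFT f ξ‖ ^ 2 := sum_le_sum fun ξ hξ ↦
          pow_le_pow_left₀ (by positivity) (mem_largeSpectrum.1 hξ).le 2
      _ ≤ _ := (sum_le_univ_sum_of_nonneg fun ξ ↦ sq_nonneg _).trans (sum_norm_realDFT_sq_le hf)
  refine le_of_mul_le_mul_right ?_ (pow_pos hn0 2)
  linarith

/-- Along any sequence of thresholds, the Fourier energy is stable at some step. -/
lemma exists_energy_stable {f : ZMod n → ℝ} (hf : ∀ x, |f x| ≤ 1) (η : ℕ → ℝ) {k : ℕ}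
    (hk : 0 < k) :
    ∃ i < k, ∑ ξ ∈ largeSpectrum f (η (i + 1)), ‖realDFT f ξ‖ ^ 2 -
      ∑ ξ ∈ largeSpectrum f (η i), ‖realDFT f ξ‖ ^ 2 ≤ (n : ℝ) ^ 2 / k := by
  have hk' : (k : ℝ) ≠ 0 := by positivity
  -- The k increments telescope to at most n², so one is at most n²/k.
  have h := sum_range_sub (fun i ↦ ∑ ξ ∈ largeSpectrum f (η i), ‖realDFT f ξ‖ ^ 2) k
  obtain ⟨i, hi, hle⟩ := exists_le_of_sum_le (nonempty_range_iff.2 hk.ne')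
    (f := fun i ↦ ∑ ξ ∈ largeSpectrum f (η (i + 1)), ‖realDFT f ξ‖ ^ 2 -
      ∑ ξ ∈ largeSpectrum f (η i), ‖realDFT f ξ‖ ^ 2) (g := fun _ ↦ (n : ℝ) ^ 2 / k) (by
        rw [h, sum_const, card_range, nsmul_eq_mul, mul_div_cancel₀ _ hk']
        have h1 : ∑ ξ ∈ largeSpectrum f (η k), ‖realDFT f ξ‖ ^ 2 ≤ (n : ℝ) ^ 2 :=
          (sum_le_univ_sum_of_nonneg fun ξ ↦ sq_nonneg _).trans (sum_norm_realDFT_sq_le hf)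
        have h2 : 0 ≤ ∑ ξ ∈ largeSpectrum f (η 0), ‖realDFT f ξ‖ ^ 2 :=
          sum_nonneg fun ξ _ ↦ sq_nonneg _
        linarith)
  exact ⟨i, mem_range.1 hi, hle⟩

/-- On `S` the weight is small; on `S' \ S` the energy is small. -/
lemma sum_energy_mul_le {f : ZMod n → ℝ} (hf : ∀ x, |f x| ≤ 1) {S S' : Finset (ZMod n)}
    (hSS' : S ⊆ S') {τ c : ℝ} (hc : 0 ≤ c)
    (hE : ∑ ξ ∈ S', ‖realDFT f ξ‖ ^ 2 - ∑ ξ ∈ S, ‖realDFT f ξ‖ ^ 2 ≤ τ ^ 2 * (n : ℝ) ^ 2)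
    {w : ZMod n → ℝ} (hw : ∀ ξ, w ξ ≤ c) (hwS : ∀ ξ ∈ S, w ξ ≤ c * τ ^ 2) :
    ∑ ξ ∈ S', ‖realDFT f ξ‖ ^ 2 * w ξ ≤ 2 * c * τ ^ 2 * (n : ℝ) ^ 2 := by
  rw [← sum_sdiff hSS'] at hE ⊢
  have h1 : ∑ ξ ∈ S' \ S, ‖realDFT f ξ‖ ^ 2 * w ξ ≤ (τ ^ 2 * (n : ℝ) ^ 2) * c := by
    calc _ ≤ ∑ ξ ∈ S' \ S, ‖realDFT f ξ‖ ^ 2 * c :=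
          sum_le_sum fun ξ _ ↦ mul_le_mul_of_nonneg_left (hw ξ) (sq_nonneg _)
      _ ≤ _ := by
          rw [← sum_mul]
          exact mul_le_mul_of_nonneg_right (by linarith) hc
  have h2 : ∑ ξ ∈ S, ‖realDFT f ξ‖ ^ 2 * w ξ ≤ (n : ℝ) ^ 2 * (c * τ ^ 2) := by
    calc _ ≤ ∑ ξ ∈ S, ‖realDFT f ξ‖ ^ 2 * (c * τ ^ 2) :=
          sum_le_sum fun ξ hξ ↦ mul_le_mul_of_nonneg_left (hwS ξ hξ) (sq_nonneg _)
      _ ≤ _ := by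
          rw [← sum_mul]
          exact mul_le_mul_of_nonneg_right
            ((sum_le_univ_sum_of_nonneg fun ξ ↦ sq_nonneg _).trans (sum_norm_realDFT_sq_le hf))
            (by positivity)
  linarith

/-- The weight is a probability distribution supported on B - B, where the character is within τ of
1. -/
lemma one_sub_autocorrDFT_le {B : Finset (ZMod n)} (hB : B.Nonempty) {ξ : ZMod n} {τ : ℝ}
    (h : ∀ b ∈ B, ∀ b' ∈ B, ‖(ZMod.stdAddChar ((b - b') * ξ) : ℂ) - 1‖ ≤ τ) :
    1 - autocorrDFT B ξ ≤ τ := by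
  have h1 : ((1 - autocorrDFT B ξ : ℝ) : ℂ) =
      ∑ d, (autocorr B d : ℂ) * (1 - ZMod.stdAddChar (d * ξ)) := by
    simp_rw [mul_sub, sum_sub_distrib, sum_autocorr_mul_stdAddChar, mul_one]
    rw [← Complex.ofReal_sum, sum_autocorr hB]; simp
  calc 1 - autocorrDFT B ξ ≤ ‖((1 - autocorrDFT B ξ : ℝ) : ℂ)‖ := by
        rw [Complex.norm_real]; exact le_abs_self _
    _ ≤ ∑ d, autocorr B d * τ := by
        rw [h1]
        refine (norm_sum_le _ _).trans (sum_le_sum fun d _ ↦ ?_)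
        rw [norm_mul, Complex.norm_real, Real.norm_of_nonneg (autocorr_nonneg B d)]
        by_cases hd : autocorr B d = 0
        · simp [hd]
        · obtain ⟨b, hb, b', hb', rfl⟩ := exists_sub_eq_of_autocorr_ne_zero hd
          rw [norm_sub_rev]
          exact mul_le_mul_of_nonneg_left (h b hb b' hb') (autocorr_nonneg B _)
    _ = τ := by rw [← sum_mul, sum_autocorr hB, one_mul]

lemma sum_autocorr_mul_smoothed (B : Finset (ZMod n)) (f : ZMod n → ℝ) :
    ∑ d, autocorr B d * ∑ x, f x * f (x + d) * smoothed B f x = ∑ x, f x * smoothed B f x ^ 2 := by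
  simp_rw [mul_sum]
  rw [sum_comm]
  refine sum_congr rfl fun x _ ↦ ?_
  calc _ = f x * smoothed B f x * smoothed B f x := by
        nth_rewrite 3 [smoothed]
        rw [mul_sum]
        exact sum_congr rfl fun d _ ↦ by ring
    _ = _ := by ring

/-! ### Counting progressions by the smoothed function. -/

/-- If the spectrum of `f` is stable between `S` and `S'`, and `S` is nearly constant on `B`,
then differences in `B - B` produce nearly the expected number of progressions. -/
theorem abs_progression_sub_le {B : Finset (ZMod n)} (hB : B.Nonempty) {f : ZMod n → ℝ}
    (hf : ∀ x, f x ∈ Set.Icc (0 : ℝ) 1) (hn : Odd n) {S S' : Finset (ZMod n)} (hSS' : S ⊆ S')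
    {τ η : ℝ} (hτ : 0 < τ) (hτ1 : τ ≤ 1) (hη : 0 ≤ η) (hη1 : η ≤ 1)
    (hηB : η * (n / #B) ≤ τ ^ 2)
    (hE : ∑ ξ ∈ S', ‖realDFT f ξ‖ ^ 2 - ∑ ξ ∈ S, ‖realDFT f ξ‖ ^ 2 ≤ τ ^ 2 * (n : ℝ) ^ 2)
    (hS' : ∀ ξ ∉ S', ‖realDFT f ξ‖ ≤ η * n)
    (hBS : ∀ b ∈ B, ∀ b' ∈ B, ∀ ξ ∈ S, ‖(ZMod.stdAddChar ((b - b') * ξ) : ℂ) - 1‖ ≤ τ) :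
    |∑ d, autocorr B d * ∑ x, f x * f (x + d) * f (x + 2 * d) -
      ∑ x, f x * smoothed B f x ^ 2| ≤ 7 * τ * n := by
  have hn0 : (0 : ℝ) < n := Nat.cast_pos.2 (NeZero.pos n)
  have hf' (x : ZMod n) : |f x| ≤ 1 := abs_le.2 ⟨by linarith [(hf x).1], (hf x).2⟩
  have hβ (ξ : ZMod n) : ‖realDFT (fun x ↦ f x - smoothed B f x) ξ‖ =
      ‖realDFT f ξ‖ * (1 - autocorrDFT B ξ) := by
    rw [realDFT_sub, realDFT_smoothed, ← one_sub_mul, norm_mul, ← Complex.ofReal_one,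
      ← Complex.ofReal_sub, Complex.norm_real,
      Real.norm_of_nonneg (sub_nonneg.2 (autocorrDFT_le_one B ξ)), mul_comm]
  -- First replacement, f by its smoothing: `sum_energy_mul_le` with c = 1 gives 2τ² ≤ (2τ)².
  have huniform : |∑ d, autocorr B d * ∑ x, f x * f (x + d) *
      (f (x + 2 * d) - smoothed B f (x + 2 * d))| ≤ (2 * τ + η * (n / #B)) * n := by
    refine abs_sum_progression_le (h := fun x ↦ f x - smoothed B f x) hB hf' hn (S := S')
      (by positivity) hη ?_ fun ξ hξ ↦ ?_
    · simp_rw [hβ, mul_pow]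
      refine (sum_energy_mul_le hf' hSS' zero_le_one hE (fun ξ ↦ ?_) fun ξ hξ ↦ ?_).trans ?_
      · exact pow_le_one₀ (sub_nonneg.2 (autocorrDFT_le_one B ξ))
          (by linarith [autocorrDFT_nonneg B ξ])
      · rw [one_mul]
        exact pow_le_pow_left₀ (sub_nonneg.2 (autocorrDFT_le_one B ξ))
          (one_sub_autocorrDFT_le hB fun b hb b' hb' ↦ hBS b hb b' hb' ξ hξ) 2
      · nlinarith [mul_pos (pow_pos hτ 2) (pow_pos hn0 2)]
    · rw [hβ]
      exact (mul_le_of_le_one_right (norm_nonneg _)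
        (by linarith [autocorrDFT_nonneg B ξ])).trans (hS' ξ hξ)
  -- Second replacement: with c = 4 the energy term is 8τ² ≤ (3τ)², and the frequencies off `S'` add
  -- 4τ², so the root of 13τ² is below 4τ. The total loss is 2τ + τ² + 4τ ≤ 7τ.
  have hshift (d : ZMod n) (hd : autocorr B d ≠ 0) :
      ∑ x, |smoothed B f (x + 2 * d) - smoothed B f x| ≤ 4 * τ * n := by
    obtain ⟨b, hb, b', hb', rfl⟩ := exists_sub_eq_of_autocorr_ne_zero hd
    refine (sum_abs_smoothed_sub_le hB (S := S') (a := 3 * τ) (η := η) ?_ hS').trans ?_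
    · refine (sum_energy_mul_le hf' hSS' zero_le_four hE (fun ξ ↦ ?_) fun ξ hξ ↦ ?_).trans ?_
      · have : ‖(ZMod.stdAddChar (2 * (b - b') * ξ) : ℂ) - 1‖ ≤ 2 := by
          refine (norm_sub_le _ _).trans ?_
          rw [norm_stdAddChar, norm_one]; norm_num
        nlinarith [norm_nonneg ((ZMod.stdAddChar (2 * (b - b') * ξ) : ℂ) - 1)]
      · have h1 : (ZMod.stdAddChar (2 * (b - b') * ξ) : ℂ) - 1 =
            ZMod.stdAddChar ((b - b') * ξ) * (ZMod.stdAddChar ((b - b') * ξ) - 1) +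
            (ZMod.stdAddChar ((b - b') * ξ) - 1) := by
          rw [mul_assoc, two_mul, AddChar.map_add_eq_mul]; ring
        have h2 : ‖(ZMod.stdAddChar (2 * (b - b') * ξ) : ℂ) - 1‖ ≤ 2 * τ := by
          rw [h1]
          refine (norm_add_le _ _).trans ?_
          rw [norm_mul, norm_stdAddChar, one_mul]
          linarith [hBS b hb b' hb' ξ hξ]
        nlinarith [norm_nonneg ((ZMod.stdAddChar (2 * (b - b') * ξ) : ℂ) - 1)]
      · nlinarith [mul_pos (pow_pos hτ 2) (pow_pos hn0 2)]
    · refine mul_le_mul_of_nonneg_right (Real.sqrt_le_iff.2 ⟨by positivity, ?_⟩) hn0.le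
      have : η ^ 2 * (n / #B) ≤ τ ^ 2 := by
        rw [pow_two, mul_assoc]
        exact (mul_le_of_le_one_left (by positivity) hη1).trans hηB
      nlinarith
  have hinv : |∑ d, autocorr B d * ∑ x, f x * f (x + d) *
      (smoothed B f (x + 2 * d) - smoothed B f x)| ≤ 4 * τ * n := by
    calc _ ≤ ∑ d, autocorr B d * (4 * τ * n) := by
          refine (abs_sum_le_sum_abs _ _).trans (sum_le_sum fun d _ ↦ ?_)
          rw [abs_mul, abs_of_nonneg (autocorr_nonneg B d)]
          by_cases hd : autocorr B d = 0
          · simp [hd]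
          refine mul_le_mul_of_nonneg_left ?_ (autocorr_nonneg B d)
          refine (abs_sum_le_sum_abs _ _).trans ((sum_le_sum fun x _ ↦ ?_).trans (hshift d hd))
          rw [abs_mul, abs_mul]
          exact mul_le_of_le_one_left (abs_nonneg _)
            (mul_le_one₀ (hf' _) (abs_nonneg _) (hf' _))
      _ = _ := by rw [← sum_mul, sum_autocorr hB, one_mul]
  have hsplit : ∑ d, autocorr B d * ∑ x, f x * f (x + d) * f (x + 2 * d) -
      ∑ x, f x * smoothed B f x ^ 2 =
      ∑ d, autocorr B d * ∑ x, f x * f (x + d) * (f (x + 2 * d) - smoothed B f (x + 2 * d)) +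
      ∑ d, autocorr B d * ∑ x, f x * f (x + d) *
        (smoothed B f (x + 2 * d) - smoothed B f x) := by
    rw [← sum_autocorr_mul_smoothed, ← sum_sub_distrib, ← sum_add_distrib]
    refine sum_congr rfl fun d _ ↦ ?_
    rw [← mul_sub, ← mul_add, ← sum_sub_distrib, ← sum_add_distrib]
    congr 1
    exact sum_congr rfl fun x _ ↦ by ring
  rw [hsplit]
  refine (abs_add_le _ _).trans ((add_le_add huniform hinv).trans ?_)
  rw [← add_mul]
  exact mul_le_mul_of_nonneg_right (by nlinarith) hn0.le

/-- Every `[0, 1]`-valued function on `ℤ/nℤ` admits a dense, short set `B` along whose differences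
the number of progressions is governed by the smoothed function. -/
theorem exists_progression_regular {ε : ℝ} (hε : 0 < ε) :
    ∃ C : ℝ, ∀ (n : ℕ) [NeZero n], Odd n → ∀ f : ZMod n → ℝ, (∀ x, f x ∈ Set.Icc (0 : ℝ) 1) →
      ∃ B : Finset (ZMod n), 0 ∈ B ∧ (n : ℝ) ≤ C * #B ∧
        (∀ b ∈ B, ‖(ZMod.stdAddChar b : ℂ) - 1‖ ≤ ε) ∧
        |∑ d, autocorr B d * ∑ x, f x * f (x + d) * f (x + 2 * d) -
          ∑ x, f x * smoothed B f x ^ 2| ≤ ε * n := by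
  set τ : ℝ := min 1 (ε / 7) with hτdef
  have hτ : 0 < τ := lt_min one_pos (by positivity)
  have hτ1 : τ ≤ 1 := min_le_left _ _
  have hτε : 7 * τ ≤ ε := by linarith [min_le_right 1 (ε / 7)]
  obtain ⟨m, hm, hm'⟩ := exists_dense_almost_constant hτ
  have hm1 : (1 : ℝ) ≤ m := by exact_mod_cast hm
  -- Bounds n/#B at threshold η: at most ⌊1/η²⌋ large frequencies, plus the extra frequency 1.
  set M : ℝ → ℝ := fun η ↦ (m : ℝ) ^ (⌊1 / η ^ 2⌋₊ + 1) with hM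
  have hM0 (η : ℝ) : 0 < M η := by simp only [hM]; positivity
  -- The next threshold is small enough to absorb the factor n/#B produced at the current one.
  set F : ℝ → ℝ := fun η ↦ min η (τ ^ 2 / M η) with hF
  set η : ℕ → ℝ := fun i ↦ F^[i] 1 with hη
  have hηs (i : ℕ) : η (i + 1) = F (η i) := Function.iterate_succ_apply' F i 1
  have hη0 (i : ℕ) : 0 < η i := by
    induction i with
    | zero => exact one_pos
    | succ i ih => rw [hηs]; exact lt_min ih (div_pos (pow_pos hτ 2) (hM0 _))
  have hηle (i : ℕ) : η (i + 1) ≤ η i := by rw [hηs]; exact min_le_left _ _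
  have hη1 (i : ℕ) : η i ≤ 1 := antitone_nat_of_succ_le hηle (Nat.zero_le i)
  obtain ⟨k, hk⟩ := exists_nat_ge (1 / τ ^ 2)
  have hk0 : (0 : ℝ) < k := lt_of_lt_of_le (by positivity) hk
  -- The stable index i depends on f and n; the sum dominates `M (η i)` for every possible i.
  refine ⟨∑ i ∈ range k, M (η i), fun n _ hn f hf ↦ ?_⟩
  have hn0 : (0 : ℝ) < n := Nat.cast_pos.2 (NeZero.pos n)
  have hf' (x : ZMod n) : |f x| ≤ 1 := abs_le.2 ⟨by linarith [(hf x).1], (hf x).2⟩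
  obtain ⟨i, hik, hi⟩ := exists_energy_stable hf' η (Nat.cast_pos.1 hk0)
  obtain ⟨B, hB0, hBcard, hB⟩ := hm' n (insert 1 (largeSpectrum f (η i)))
  have hBne : B.Nonempty := ⟨0, hB0⟩
  have hBpos : (0 : ℝ) < #B := by exact_mod_cast hBne.card_pos
  have hBM : (n : ℝ) ≤ M (η i) * #B := by
    refine hBcard.trans (mul_le_mul_of_nonneg_right (pow_le_pow_right₀ hm1 ?_) hBpos.le)
    exact (card_insert_le _ _).trans (Nat.succ_le_succ (card_largeSpectrum_le hf' (hη0 i)))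
  refine ⟨B, hB0, hBM.trans (mul_le_mul_of_nonneg_right ?_ hBpos.le), fun b hb ↦ ?_, ?_⟩
  · exact single_le_sum (fun j _ ↦ (hM0 (η j)).le) (mem_range.2 hik)
  · have := hB b hb 0 hB0 1 (mem_insert_self _ _)
    rw [sub_zero, mul_one] at this
    linarith
  · refine (abs_progression_sub_le hBne hf hn (largeSpectrum_anti f (hηle i)) hτ hτ1
      (hη0 (i + 1)).le (hη1 _) ?_ (hi.trans ?_) (fun ξ hξ ↦ not_lt.1 (mem_largeSpectrum.not.1 hξ))
      fun b hb b' hb' ξ hξ ↦ hB b hb b' hb' ξ (mem_insert_of_mem hξ)).trans ?_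
    · calc η (i + 1) * (n / #B) ≤ τ ^ 2 / M (η i) * M (η i) := by
            refine mul_le_mul ?_ ((div_le_iff₀ hBpos).2 hBM) (by positivity)
              (div_nonneg (sq_nonneg τ) (hM0 _).le)
            rw [hηs]; exact min_le_right _ _
        _ = τ ^ 2 := div_mul_cancel₀ _ (hM0 _).ne'
    · rw [div_le_iff₀ hk0]
      have : 1 ≤ τ ^ 2 * k := by rwa [div_le_iff₀ (by positivity), mul_comm] at hk
      nlinarith [pow_pos hn0 2]
    · exact mul_le_mul_of_nonneg_right hτε hn0.le

/-! ### Lower bound for the smoothed third moment. -/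

lemma sum_mul_smoothed_eq (B : Finset (ZMod n)) (f : ZMod n → ℝ) :
    (#B : ℝ) ^ 2 * ∑ x, f x * smoothed B f x = ∑ y, (∑ b ∈ B, f (y - b)) ^ 2 := by
  by_cases hB : B = ∅
  · simp [hB]
  have hB' : (#B : ℝ) ^ 2 ≠ 0 := by simpa using hB
  have h (x : ZMod n) : f x * smoothed B f x =
      ((#B : ℝ) ^ 2)⁻¹ * ∑ b ∈ B, ∑ b' ∈ B, f x * f (x + (b - b')) := by
    have := sum_autocorr_smul B fun d ↦ f x * f (x + d)
    simp only [smul_eq_mul] at this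
    rw [← this, smoothed, mul_sum]
    exact sum_congr rfl fun d _ ↦ by ring
  simp_rw [h]
  rw [← mul_sum, mul_inv_cancel_left₀ hB']
  simp_rw [pow_two, sum_mul_sum]
  rw [sum_comm, sum_comm (s := univ)]
  refine sum_congr rfl fun b _ ↦ ?_
  rw [sum_comm, sum_comm (s := univ)]
  refine sum_congr rfl fun b' _ ↦ ?_
  refine Fintype.sum_equiv (Equiv.addRight b) _ _ fun x ↦ ?_
  simp only [Equiv.coe_addRight, add_sub_cancel_right, add_sub_assoc]

/-- Cauchy–Schwarz for the convolution of f with the indicator of `B`, which is supported on A + B.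
-/
lemma sum_sq_le_card_add_mul {A B : Finset (ZMod n)} (hB : B.Nonempty) {f : ZMod n → ℝ}
    (hf : ∀ x ∉ A, f x = 0) :
    (∑ x, f x) ^ 2 ≤ #(A + B) * ∑ x, f x * smoothed B f x := by
  have hB' : (0 : ℝ) < (#B : ℝ) ^ 2 := by have := hB.card_pos; positivity
  have h1 : ∑ y ∈ A + B, ∑ b ∈ B, f (y - b) = #B * ∑ x, f x := by
    have h2 : ∑ y ∈ A + B, ∑ b ∈ B, f (y - b) = ∑ y, ∑ b ∈ B, f (y - b) := by
      refine sum_subset (subset_univ _) fun y _ hy ↦ sum_eq_zero fun b hb ↦ hf _ fun hA ↦ hy ?_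
      rw [← sub_add_cancel y b]; exact add_mem_add hA hb
    rw [h2, sum_comm, ← nsmul_eq_mul, ← sum_const]
    exact sum_congr rfl fun b _ ↦ Fintype.sum_equiv (Equiv.subRight b) _ _ fun x ↦ rfl
  refine le_of_mul_le_mul_left ?_ hB'
  calc (#B : ℝ) ^ 2 * (∑ x, f x) ^ 2 = (∑ y ∈ A + B, ∑ b ∈ B, f (y - b)) ^ 2 := by
        rw [h1, mul_pow]
    _ ≤ #(A + B) * ∑ y ∈ A + B, (∑ b ∈ B, f (y - b)) ^ 2 := sq_sum_le_card_mul_sum_sq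
    _ ≤ #(A + B) * ∑ y, (∑ b ∈ B, f (y - b)) ^ 2 := mul_le_mul_of_nonneg_left
        (sum_le_univ_sum_of_nonneg fun y ↦ sq_nonneg _) (Nat.cast_nonneg _)
    _ = _ := by rw [← sum_mul_smoothed_eq]; ring

/-- Smoothing a function along a set with small sumset essentially increases the third moment. -/
theorem sum_pow_three_le {A B : Finset (ZMod n)} (hB : B.Nonempty) {f : ZMod n → ℝ}
    (hf0 : ∀ x, 0 ≤ f x) (hf : ∀ x ∉ A, f x = 0) :
    (∑ x, f x) ^ 3 ≤ (#(A + B) : ℝ) ^ 2 * ∑ x, f x * smoothed B f x ^ 2 := by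
  have hP : 0 ≤ ∑ x, f x * smoothed B f x ^ 2 :=
    sum_nonneg fun x _ ↦ mul_nonneg (hf0 x) (sq_nonneg _)
  obtain h0 | h0 := (sum_nonneg fun x _ ↦ hf0 x : 0 ≤ ∑ x, f x).eq_or_lt
  · rw [← h0, zero_pow three_ne_zero]; exact mul_nonneg (sq_nonneg _) hP
  -- Cauchy–Schwarz with respect to the weight f; one factor ∑ f is cancelled at the end.
  have hcs : (∑ x, f x * smoothed B f x) ^ 2 ≤
      (∑ x, f x) * ∑ x, f x * smoothed B f x ^ 2 := by
    refine sum_sq_le_sum_mul_sum_of_sq_le_mul _ (fun x _ ↦ hf0 x)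
      (fun x _ ↦ mul_nonneg (hf0 x) (sq_nonneg _)) fun x _ ↦ le_of_eq (by ring)
  refine le_of_mul_le_mul_left ?_ h0
  calc (∑ x, f x) * (∑ x, f x) ^ 3 = ((∑ x, f x) ^ 2) ^ 2 := by ring
    _ ≤ (#(A + B) * ∑ x, f x * smoothed B f x) ^ 2 :=
        pow_le_pow_left₀ (sq_nonneg _) (sum_sq_le_card_add_mul hB hf) 2
    _ = (#(A + B) : ℝ) ^ 2 * (∑ x, f x * smoothed B f x) ^ 2 := by ring
    _ ≤ (#(A + B) : ℝ) ^ 2 * ((∑ x, f x) * ∑ x, f x * smoothed B f x ^ 2) :=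
        mul_le_mul_of_nonneg_left hcs (sq_nonneg _)
    _ = _ := by ring

/-! ### Transfer between ℤ and ℤ/nℤ. -/

/-- With v the representative of b, the chord length is 2|sin(πv/n)|, and Jordan's inequality bounds
it below by 4|v|/n. -/
lemma abs_valMinAbs_le_of_norm_stdAddChar_sub_one_le {b : ZMod n} {ε : ℝ}
    (h : ‖(ZMod.stdAddChar b : ℂ) - 1‖ ≤ ε) : |(b.valMinAbs : ℝ)| ≤ ε * n / 4 := by
  have hn0 : (0 : ℝ) < n := Nat.cast_pos.2 (NeZero.pos n)
  have hv : |(b.valMinAbs : ℝ)| ≤ n / 2 := by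
    have h1 := ZMod.natAbs_valMinAbs_le b
    rw [← Int.cast_abs, Int.abs_eq_natAbs, Int.cast_natCast]
    exact (Nat.cast_le.2 h1).trans Nat.cast_div_le
  have hexp : (ZMod.stdAddChar b : ℂ) =
      Complex.exp (Complex.I * ((2 * Real.pi * b.valMinAbs / n : ℝ) : ℂ)) := by
    conv_lhs => rw [← ZMod.coe_valMinAbs b]
    rw [ZMod.stdAddChar_coe]
    congr 1; push_cast; ring
  rw [hexp, Complex.norm_exp_I_mul_ofReal_sub_one, Real.norm_eq_abs, abs_mul, abs_two] at h
  set θ : ℝ := 2 * Real.pi * b.valMinAbs / n / 2 with hθ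
  have hθabs : |θ| = Real.pi * (|(b.valMinAbs : ℝ)| / n) := by
    rw [hθ, show 2 * Real.pi * (b.valMinAbs : ℝ) / n / 2 = Real.pi * (b.valMinAbs / n) by ring,
      abs_mul, abs_of_pos Real.pi_pos, abs_div, abs_of_pos hn0]
  have hle : |(b.valMinAbs : ℝ)| / n ≤ 1 / 2 := by rw [div_le_iff₀ hn0]; linarith
  have hθle : |θ| ≤ Real.pi / 2 := by
    rw [hθabs]; nlinarith [Real.pi_pos]
  have hsin := Real.mul_le_sin (abs_nonneg θ) hθle
  have hsin' : |Real.sin θ| = Real.sin |θ| :=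
    Real.abs_sin_eq_sin_abs_of_abs_le_pi (by linarith [Real.pi_pos])
  rw [← hsin', hθabs, ← mul_assoc, div_mul_cancel₀ _ Real.pi_pos.ne'] at hsin
  have : |(b.valMinAbs : ℝ)| / n ≤ ε / 4 := by linarith
  rw [div_le_iff₀ hn0] at this
  linarith

lemma card_image_add_le {N : ℕ} {A : Finset ℤ} (hA : A ⊆ Icc 1 (N : ℤ))
    {B : Finset (ZMod n)} {ε : ℝ} (hε : 0 ≤ ε)
    (hB : ∀ b ∈ B, ‖(ZMod.stdAddChar b : ℂ) - 1‖ ≤ ε) :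
    (#(A.image (Int.cast : ℤ → ZMod n) + B) : ℝ) ≤ N + ε * n / 2 := by
  set w : ℕ := ⌊ε * n / 4⌋₊ with hw
  have hsub : A.image (Int.cast : ℤ → ZMod n) + B ⊆
      (Icc (1 - (w : ℤ)) (N + w)).image Int.cast := by
    intro x hx
    obtain ⟨_, ha', b, hb, rfl⟩ := mem_add.1 hx
    obtain ⟨a, ha, rfl⟩ := mem_image.1 ha'
    have h1 : b.valMinAbs.natAbs ≤ w := by
      refine Nat.le_floor ?_
      rw [Nat.cast_natAbs, Int.cast_abs]
      exact abs_valMinAbs_le_of_norm_stdAddChar_sub_one_le (hB b hb)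
    have h2 := mem_Icc.1 (hA ha)
    refine mem_image.2 ⟨a + b.valMinAbs, mem_Icc.2 ⟨by omega, by omega⟩, ?_⟩
    rw [Int.cast_add, ZMod.coe_valMinAbs]
  have h1 : #(A.image (Int.cast : ℤ → ZMod n) + B) ≤ N + 2 * w := by
    refine (card_le_card hsub).trans (card_image_le.trans ?_)
    rw [Int.card_Icc]; omega
  have h2 : (w : ℝ) ≤ ε * n / 4 := Nat.floor_le (by positivity)
  have h3 : (#(A.image (Int.cast : ℤ → ZMod n) + B) : ℝ) ≤ N + 2 * w := by exact_mod_cast h1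
  linarith

lemma eq_of_cast_eq {N : ℕ} {a b : ℤ} (h : (a : ZMod (4 * N + 1)) = b)
    (hab : |a - b| ≤ 4 * N) : a = b := by
  have h1 := (ZMod.intCast_eq_intCast_iff_dvd_sub _ _ _).1 h
  have h2 := Int.eq_zero_of_abs_lt_dvd h1 (by rw [abs_sub_comm]; push_cast; omega)
  omega

lemma card_image_cast {N : ℕ} {A : Finset ℤ} (hA : A ⊆ Icc 1 (N : ℤ)) :
    #(A.image (Int.cast : ℤ → ZMod (4 * N + 1))) = #A := by
  refine card_image_of_injOn fun a ha b hb h ↦ eq_of_cast_eq h ?_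
  have h1 := mem_Icc.1 (hA ha)
  have h2 := mem_Icc.1 (hA hb)
  rw [abs_le]; omega

/-- The representative of d has size at most 2N, so each congruence compares integers less than 3N
apart; modulo 4N + 1 it is an equality. -/
lemma card_progressions_le_numThreeAP {N : ℕ} {A : Finset ℤ} (hA : A ⊆ Icc 1 (N : ℤ))
    {A' : Finset (ZMod (4 * N + 1))} (hA' : A' = A.image Int.cast) (d : ZMod (4 * N + 1)) :
    #{x | x ∈ A' ∧ x + d ∈ A' ∧ x + 2 * d ∈ A'} ≤ numThreeAP A d.valMinAbs := by
  refine (card_le_card (t := {x ∈ A | x + d.valMinAbs ∈ A ∧ x + 2 * d.valMinAbs ∈ A}.image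
    Int.cast) fun x hx ↦ ?_).trans card_image_le
  simp only [mem_filter, mem_univ, true_and, hA', mem_image] at hx
  obtain ⟨⟨a, ha, rfl⟩, ⟨a₁, ha₁, h₁⟩, a₂, ha₂, h₂⟩ := hx
  have hd := ZMod.natAbs_valMinAbs_le d
  have hda : (d.valMinAbs : ZMod (4 * N + 1)) = d := ZMod.coe_valMinAbs d
  have b0 := mem_Icc.1 (hA ha)
  have b1 := mem_Icc.1 (hA ha₁)
  have b2 := mem_Icc.1 (hA ha₂)
  have e1 : a + d.valMinAbs = a₁ := by
    refine eq_of_cast_eq (by rw [Int.cast_add, hda, h₁]) ?_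
    rw [abs_le]; omega
  have e2 : a₁ + d.valMinAbs = a₂ := by
    refine eq_of_cast_eq (by rw [Int.cast_add, hda, h₁, h₂]; ring) ?_
    rw [abs_le]; omega
  refine mem_image.2 ⟨a, mem_filter.2 ⟨ha, ?_, ?_⟩, rfl⟩
  · rwa [e1]
  · rwa [two_mul, ← add_assoc, e1, e2]

end PopularDifference

/-! ### Conclusion. -/

open Finset PopularDifference Pointwise in
theorem theorem1p9 :
    ∀ α ε : ℝ, 0 < α → 0 < ε →
      ∃ N₀ : ℕ, ∀ N : ℕ, N₀ < N →
        ∀ A : Finset ℤ, A ⊆ Finset.Icc 1 (N : ℤ) → (A.card : ℝ) = α * (N : ℝ) →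
          ∃ d : ℤ, d ≠ 0 ∧ (α ^ 3 - ε) * (N : ℝ) ≤ (numThreeAP A d : ℝ) := by
  intro α ε _ hε
  -- The losses are 15κN/2 from the third moment and 5κN from regularity, together at most εN/2; the
  -- term d = 0 takes the other half. The bound 2/5 is what (1 + 5κ/2)² ≤ 1 + 15κ/2 requires.
  set κ : ℝ := min (ε / 25) (2 / 5) with hκdef
  have hκ : 0 < κ := lt_min (by positivity) (by norm_num)
  have hκε : κ ≤ ε / 25 := min_le_left _ _
  have hκ1 : κ ≤ 2 / 5 := min_le_right _ _
  obtain ⟨C, hC⟩ := exists_progression_regular hκ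
  obtain ⟨N₀, hN₀⟩ := exists_nat_ge (2 * C / ε)
  refine ⟨N₀, fun N hN A hA hcard ↦ ?_⟩
  have hNpos : (0 : ℝ) < N := Nat.cast_pos.2 (by omega)
  have hN1 : (1 : ℝ) ≤ N := Nat.one_le_cast.2 (by omega)
  have hNC : C < ε / 2 * N := by
    have h1 : 2 * C / ε < N := hN₀.trans_lt (Nat.cast_lt.2 hN)
    rw [div_lt_iff₀ hε] at h1; linarith
  by_contra! hcon
  -- Nonnegativity allows the term d = 0 to be included in the full weighted average of the assumed
  -- upper bound.
  have hlow : 0 ≤ (α ^ 3 - ε) * N := (Nat.cast_nonneg _).trans (hcon 1 one_ne_zero).le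
  set A' : Finset (ZMod (4 * N + 1)) := A.image Int.cast with hA'
  set f : ZMod (4 * N + 1) → ℝ := fun x ↦ if x ∈ A' then 1 else 0 with hf
  have hfIcc (x) : f x ∈ Set.Icc (0 : ℝ) 1 := by
    simp only [hf]; split_ifs <;> simp
  have hfsum : ∑ x, f x = α * N := by
    rw [← hcard, ← card_image_cast hA, ← hA']; simp [hf]
  have hAN : α * N ≤ N := by
    rw [← hcard]
    have := card_le_card hA
    rw [Int.card_Icc] at this
    exact_mod_cast this.trans (by omega)
  obtain ⟨B, hB0, hBC, hBκ, hreg⟩ := hC (4 * N + 1) ⟨2 * N, by ring⟩ f hfIcc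
  have hBne : B.Nonempty := ⟨0, hB0⟩
  have hBpos : (0 : ℝ) < #B := by exact_mod_cast hBne.card_pos
  have hn5 : ((4 * N + 1 : ℕ) : ℝ) ≤ 5 * N := by push_cast; linarith
  set P : ℝ := ∑ x, f x * smoothed B f x ^ 2 with hP
  have hPN : P ≤ N := by
    refine le_trans (sum_le_sum fun x _ ↦ ?_) (hfsum.le.trans hAN)
    have hs := smoothed_mem_Icc hBne hfIcc x
    exact mul_le_of_le_one_right (hfIcc x).1 (pow_le_one₀ hs.1 hs.2)
  have hP0 : 0 ≤ P := sum_nonneg fun x _ ↦ mul_nonneg (hfIcc x).1 (sq_nonneg _)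
  have hPlow : α ^ 3 * N - 15 / 2 * κ * N ≤ P := by
    have h1 := sum_pow_three_le (A := A') hBne (fun x ↦ (hfIcc x).1) (f := f)
      fun x hx ↦ if_neg hx
    have h2 : (#(A' + B) : ℝ) ≤ N * (1 + 5 / 2 * κ) :=
      (card_image_add_le hA hκ.le hBκ).trans (by nlinarith)
    rw [hfsum] at h1
    have h3 : (α * N) ^ 3 ≤ (N * (1 + 5 / 2 * κ)) ^ 2 * P :=
      h1.trans (mul_le_mul_of_nonneg_right (pow_le_pow_left₀ (Nat.cast_nonneg _) h2 2) hP0)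
    have h4 : α ^ 3 * N ≤ (1 + 5 / 2 * κ) ^ 2 * P := by
      refine le_of_mul_le_mul_left ?_ (pow_pos hNpos 2)
      calc _ = (α * N) ^ 3 := by ring
        _ ≤ _ := h3
        _ = _ := by ring
    have h5 : (1 + 5 / 2 * κ) ^ 2 ≤ 1 + 15 / 2 * κ := by nlinarith
    have h6 : 15 / 2 * κ * P ≤ 15 / 2 * κ * N := mul_le_mul_of_nonneg_left hPN (by positivity)
    linarith [mul_le_mul_of_nonneg_right h5 hP0]
  have hcount (d : ZMod (4 * N + 1)) : ∑ x, f x * f (x + d) * f (x + 2 * d) =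
      #{x | x ∈ A' ∧ x + d ∈ A' ∧ x + 2 * d ∈ A'} := by
    rw [card_filter]
    push_cast
    refine sum_congr rfl fun x _ ↦ ?_
    simp only [hf, ite_and]
    split_ifs <;> simp
  have hterm (d : ZMod (4 * N + 1)) :
      autocorr B d * ∑ x, f x * f (x + d) * f (x + 2 * d) ≤
        (if d = 0 then autocorr B 0 * N else 0) + autocorr B d * ((α ^ 3 - ε) * N) := by
    split_ifs with hd
    · subst hd
      refine le_add_of_le_of_nonneg (mul_le_mul_of_nonneg_left ?_ (autocorr_nonneg B 0))
        (mul_nonneg (autocorr_nonneg B 0) hlow)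
      refine le_trans (sum_le_sum fun x _ ↦ ?_) (hfsum.le.trans hAN)
      rw [mul_assoc]
      exact mul_le_of_le_one_right (hfIcc _).1
        (mul_le_one₀ (hfIcc _).2 (hfIcc _).1 (hfIcc _).2)
    · rw [zero_add, hcount]
      refine mul_le_mul_of_nonneg_left ?_ (autocorr_nonneg B d)
      have hd' : d.valMinAbs ≠ 0 := fun h ↦ hd ((ZMod.valMinAbs_eq_zero d).1 h)
      exact (Nat.cast_le.2 (card_progressions_le_numThreeAP hA hA' d)).trans (hcon _ hd').le
  have hupper := sum_le_sum fun d (_ : d ∈ univ) ↦ hterm d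
  rw [sum_add_distrib, ← sum_mul, sum_autocorr hBne, one_mul, sum_ite_eq' univ,
    if_pos (mem_univ _), autocorr_zero hBne] at hupper
  -- The term d = 0 has weight 1/#B, and N ≤ n ≤ C · #B.
  have hzero : (#B : ℝ)⁻¹ * N ≤ C := by
    rw [inv_mul_le_iff₀ hBpos, mul_comm]
    refine le_trans ?_ hBC
    push_cast; linarith
  have hdiff := (abs_le.1 hreg).1
  have hκn : κ * ((4 * N + 1 : ℕ) : ℝ) ≤ κ * (5 * N) := mul_le_mul_of_nonneg_left hn5 hκ.le
  have hκN : κ * N ≤ ε / 25 * N := mul_le_mul_of_nonneg_right hκε hNpos.le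
  linarith
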